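/- A quantum circuit on finitely many qubits is a sequence of layers, each layer consisting of arbitrary one- and two-qubit unitary gates on pairwise disjoint sets of qubits; its depth is the number of layers. For a complex $n\times n$ matrix $A$, with $k=\lceil\log_2 n\rceil$ data qubits, a circuit with unitary $U$ on $a$ ancilla qubits and the $k$ data qubits is an (exact) block encoding of $A$ if $(\langle 0^a|\otimes I)\,U\,(|0^a\rangle\otimes I)=\sum_{i,j=1}^{n}A_{ij}\,|i-1\rangle\langle j-1|$ (so that $A$ is the top left block of $U$). There is a universal constant $C$ with the following property. Let $n\ge 2$, let $f$ be a univariate real polynomial, let $\mathcal P>0$ be such that $|f'(t)|\le\mathcal P$ for all $t\in[-\frac12,\frac12]$, and let $x_1,\dots,x_n\in[-\frac12,\frac12]$; put $x_{n+1}=x_1$ and $$\mathcal M_3=\frac1{\mathcal P}\sum_{i=1}^{n}\bigl(f'(x_{i+1})-f'(x_i)\bigr)\,|i-1\rangle\langle i-1| .$$ If $n\in\{2,3\}$, assume moreover that $\bigl\|\frac1{\sqrt n}\mathcal M_3\bigr\|\le 1$, i.e. $|f'(x_{i+1})-f'(x_i)|\le\sqrt n\,\mathcal P$ for all $i$ (for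 $n\ge4$ this is automatic). Then, for some number $a$ of ancilla qubits, there is a quantum circuit of depth at most $C\,\max(1,\deg f)\,\log n$ that is a block encoding of $\frac1{\sqrt n}\mathcal M_3$. -/

import Mathlib

/-! ## Quantum circuits over arbitrary one- and two-qubit gates

The qubits (wires) are the elements of a finite type `W`; the computational basis of the state
space is `W → Fin 2`, and operators are matrices over that basis. -/

namespace QCirc

/-- A gate: an arbitrary unitary on one qubit, or on an ordered pair of distinct qubits. -/
inductive Gate (W : Type) : Type where
  | one (w : W) (u : Matrix.unitaryGroup (Fin 2) ℂ) : Gate W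
  | two (v w : W) (hvw : v ≠ w) (u : Matrix.unitaryGroup (Fin 2 × Fin 2) ℂ) : Gate W

/-- The qubits a gate acts on. -/
def Gate.wires {W : Type} [DecidableEq W] : Gate W → Finset W
  | .one w _ => {w}
  | .two v w _ _ => {v, w}

/-- The operator of a gate on the whole register: the given unitary on the qubits of the gate,
tensored with the identity on all the others. -/
noncomputable def Gate.toMatrix {W : Type} [Fintype W] [DecidableEq W] :
    Gate W → Matrix (W → Fin 2) (W → Fin 2) ℂ
  | .one w u => Matrix.of fun x y =>
      if ∀ s, s ≠ w → x s = y s then u.1 (x w) (y w) else 0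
  | .two v w _ u => Matrix.of fun x y =>
      if ∀ s, s ≠ v → s ≠ w → x s = y s then u.1 (x v, x w) (y v, y w) else 0

/-- A layer: gates on pairwise disjoint sets of qubits, carried out in parallel. -/
structure Layer (W : Type) [DecidableEq W] where
  gates : List (Gate W)
  disjoint : gates.Pairwise fun g h => Disjoint g.wires h.wires

/-- The operator of a layer (its gates commute, so their order is immaterial). -/
noncomputable def Layer.toMatrix {W : Type} [Fintype W] [DecidableEq W] (l : Layer W) :
    Matrix (W → Fin 2) (W → Fin 2) ℂ :=
  (l.gates.map Gate.toMatrix).prod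

/-- A quantum circuit: a sequence of layers, the head of the list being carried out first. -/
abbrev Circuit (W : Type) [DecidableEq W] : Type := List (Layer W)

/-- The operator of a circuit. -/
noncomputable def Circuit.toMatrix {W : Type} [Fintype W] [DecidableEq W] :
    Circuit W → Matrix (W → Fin 2) (W → Fin 2) ℂ
  | [] => 1
  | l :: c => Circuit.toMatrix c * l.toMatrix

/-- The depth of a circuit: its number of layers. -/
def Circuit.depth {W : Type} [DecidableEq W] (c : Circuit W) : ℕ := c.length

/-! ## Block encodings -/

/-- The number `i` whose basis ket `|i⟩` of `k` qubits is the bit string `x`, that is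
`∑ⱼ xⱼ 2^(k-1-j)` (the qubit `0` is the most significant bit). -/
def ketIndex {k : ℕ} (x : Fin k → Fin 2) : ℕ :=
  ∑ j : Fin k, (x j : ℕ) * 2 ^ (j.rev : ℕ)

/-- The operator `∑_{i,j < n} A i j |i⟩⟨j|` on `k` qubits. For `n = 2 ^ k` this is the matrix `A`
itself; for `n < 2 ^ k` it is `A` in the top left corner and zeros elsewhere. -/
noncomputable def onQubits {n : ℕ} (k : ℕ) (A : Matrix (Fin n) (Fin n) ℂ) :
    Matrix (Fin k → Fin 2) (Fin k → Fin 2) ℂ :=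
  Matrix.of fun x y =>
    if h : ketIndex x < n ∧ ketIndex y < n then A ⟨ketIndex x, h.1⟩ ⟨ketIndex y, h.2⟩ else 0

/-- `U`, an operator on `a` ancilla qubits and `k` data qubits, is an exact block encoding of the
`n × n` matrix `A`: it is unitary, and `(⟨0ᵃ| ⊗ I) U (|0ᵃ⟩ ⊗ I) = A`, where `A` acts on the span
of `|0⟩, …, |n - 1⟩` in the data register. -/
def IsBlockEncoding {n a k : ℕ}
    (U : Matrix (Fin a ⊕ Fin k → Fin 2) (Fin a ⊕ Fin k → Fin 2) ℂ)
    (A : Matrix (Fin n) (Fin n) ℂ) : Prop :=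
  n ≤ 2 ^ k ∧ U ∈ Matrix.unitaryGroup (Fin a ⊕ Fin k → Fin 2) ℂ ∧
    ∀ x y : Fin k → Fin 2,
      U (Sum.elim (fun _ => 0) x) (Sum.elim (fun _ => 0) y) = onQubits k A x y

/-! ## The matrix of differences of derivatives -/

/-- The matrix `(1 / P) ∑ᵢ (f'(xᵢ₊₁) - f'(xᵢ)) |i⟩⟨i|`, the index `i` being cyclic
(`finRotate n` sends `i` to `i + 1` and `n - 1` to `0`). -/
noncomputable def diffMatrix {n : ℕ} (f : Polynomial ℝ) (P : ℝ) (x : Fin n → ℝ) :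
    Matrix (Fin n) (Fin n) ℂ :=
  Matrix.diagonal fun i =>
    (((f.derivative.eval (x (finRotate n i)) - f.derivative.eval (x i)) / P : ℝ) : ℂ)

end QCirc

/-! Every diagonal matrix with real entries `d x ∈ [-1, 1]` on `k` qubits has a block encoding of
depth `2 k + 5`, the number of ancillas being free; the theorem applies this to the matrix of
differences, divided by `√n P`: since `|f'| ≤ P`, each difference is at most `2 P ≤ √n P` if `4 ≤ n`.

Write `d x = cos (θ x)` and add one qubit `b`. The diagonal unitary with phases
`exp (i (-1)ᵇ θ x)`, put between two Hadamard gates on `b`, block encodes `cos (θ x)`. So it remains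
to carry out an arbitrary diagonal unitary `exp (i φ z)` on the `k + 1` bits `z`. By Walsh expansion
(`exists_walsh`), `φ z = ∑ S, c S * (-1) ^ (∑ j ∈ S, z j)`, so that once the parity of every subset
`S` of the bits sits on a wire of its own, one layer of one-qubit phase gates suffices.

The parities come from one qubit for each subset `S`, with bit `j` initially on the wire `{j}` and
`0` on all other wires. The layer `t` applies a CNOT from `S` to `insert t S` for all `S ∌ t`; these
gates are disjoint, and the `k + 1` layers together add to the wire `S` the contents of all its
subsets, which is the parity of the bits in `S` (`stepAdd_partialParity`). The same layers in
reverse order undo this. -/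

namespace QCirc

/-! ### Operators permuting or scaling the basis kets -/

section Register

variable {W : Type} [Fintype W] [DecidableEq W]

/-- The operator that sends the basis ket `|y⟩` to `|σ y⟩`. -/
noncomputable def ketMap (σ : (W → Fin 2) → (W → Fin 2)) : Matrix (W → Fin 2) (W → Fin 2) ℂ :=
  Matrix.of fun x y => if x = σ y then 1 else 0

omit [DecidableEq W] in
lemma ketMap_id : ketMap (id : (W → Fin 2) → (W → Fin 2)) = 1 := by
  ext x y
  simp [ketMap, Matrix.one_apply]

lemma ketMap_mul (σ τ : (W → Fin 2) → (W → Fin 2)) :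
    ketMap σ * ketMap τ = ketMap (σ ∘ τ) := by
  ext x y
  simp [ketMap, Matrix.mul_apply]

lemma ketMap_mul_diagonal_mul_ketMap {σ τ : (W → Fin 2) → (W → Fin 2)} (h : σ ∘ τ = id)
    (g : (W → Fin 2) → ℂ) :
    ketMap σ * Matrix.diagonal g * ketMap τ = Matrix.diagonal (g ∘ τ) := by
  ext x y
  have h' : σ (τ y) = y := congrFun h y
  simp only [ketMap, Matrix.mul_apply, Matrix.of_apply, mul_ite, mul_one,
    mul_zero, Finset.sum_ite_eq', Finset.mem_univ, if_true, h',
    Matrix.diagonal_apply, Function.comp]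
  by_cases hxy : x = y
  · subst hxy; simp
  · simp [hxy]

/-! ### One-qubit gates -/

lemma sum_one_toMatrix_mul (w : W) (u : Matrix.unitaryGroup (Fin 2) ℂ) (x : W → Fin 2)
    (F : (W → Fin 2) → ℂ) :
    ∑ z, (Gate.one w u).toMatrix x z * F z = ∑ b, u.1 (x w) b * F (Function.update x w b) := by
  have key : ∀ z, (Gate.one w u).toMatrix x z * F z
      = ∑ b, if z = Function.update x w b then u.1 (x w) b * F z else 0 := by
    intro z
    have hz : ∀ b, z = Function.update x w b ↔ (∀ s, s ≠ w → x s = z s) ∧ z w = b := by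
      intro b
      rw [Function.eq_update_iff]
      constructor
      · rintro ⟨h1, h2⟩
        exact ⟨fun s hs => (h2 s hs).symm, h1⟩
      · rintro ⟨h1, h2⟩
        exact ⟨h2, fun s hs => (h1 s hs).symm⟩
    simp only [hz, Gate.toMatrix, Matrix.of_apply]
    by_cases h : ∀ s, s ≠ w → x s = z s
    · simp only [ite_and, if_pos h, Finset.sum_ite_eq, Finset.mem_univ, if_true]
    · simp only [ite_and, if_neg h, zero_mul, Finset.sum_const_zero]
  simp_rw [key]
  rw [Finset.sum_comm]
  simp

lemma one_toMatrix_mul (w : W) (u v : Matrix.unitaryGroup (Fin 2) ℂ) :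
    (Gate.one w u).toMatrix * (Gate.one w v).toMatrix = (Gate.one w (u * v)).toMatrix := by
  ext x y
  rw [Matrix.mul_apply, sum_one_toMatrix_mul]
  have h : ∀ b, (∀ s, s ≠ w → Function.update x w b s = y s) ↔ (∀ s, s ≠ w → x s = y s) := by
    intro b
    refine forall_congr' fun s => imp_congr_right fun hs => ?_
    rw [Function.update_of_ne hs]
  simp only [Gate.toMatrix, Matrix.of_apply, h, Function.update_self]
  by_cases hxy : ∀ s, s ≠ w → x s = y s
  · simp only [if_pos hxy, Matrix.mul_apply, Submonoid.coe_mul]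
  · simp [hxy]

lemma one_one_toMatrix (w : W) : (Gate.one w 1).toMatrix = 1 := by
  ext x y
  by_cases hxy : x = y
  · subst hxy; simp [Gate.toMatrix]
  · by_cases h : ∀ s, s ≠ w → x s = y s
    · have hw : x w ≠ y w := fun hw => hxy <| funext fun s => by
        by_cases hs : s = w
        · rw [hs, hw]
        · exact h s hs
      simp [Gate.toMatrix, hxy, hw]
    · simp [Gate.toMatrix, hxy, h]

lemma star_one_toMatrix (w : W) (u : Matrix.unitaryGroup (Fin 2) ℂ) :
    star (Gate.one w u).toMatrix = (Gate.one w (star u)).toMatrix := by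
  ext x y
  have h : (∀ s, s ≠ w → x s = y s) ↔ (∀ s, s ≠ w → y s = x s) :=
    forall_congr' fun s => imp_congr_right fun _ => eq_comm
  simp only [Matrix.star_apply, Gate.toMatrix, Matrix.of_apply, h]
  split_ifs <;> simp

lemma one_toMatrix_mem_unitaryGroup (w : W) (u : Matrix.unitaryGroup (Fin 2) ℂ) :
    (Gate.one w u).toMatrix ∈ Matrix.unitaryGroup (W → Fin 2) ℂ := by
  rw [Matrix.mem_unitaryGroup_iff, star_one_toMatrix, one_toMatrix_mul, ← one_one_toMatrix w]
  congr 2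
  exact Unitary.mul_star_self u

/-- The Hadamard gate. -/
noncomputable def hadamard : Matrix.unitaryGroup (Fin 2) ℂ :=
  ⟨((1 / Real.sqrt 2 : ℝ) : ℂ) • !![1, 1; 1, -1], by
    have h : ((Real.sqrt 2 : ℝ) : ℂ) * ((Real.sqrt 2 : ℝ) : ℂ) = 2 := by
      rw [← Complex.ofReal_mul, Real.mul_self_sqrt (by norm_num)]; norm_num
    have h' : ((Real.sqrt 2 : ℝ) : ℂ)⁻¹ * ((Real.sqrt 2 : ℝ) : ℂ)⁻¹ = 1 / 2 := by
      rw [← mul_inv, h]; norm_num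
    rw [Matrix.mem_unitaryGroup_iff]
    ext i j
    fin_cases i <;> fin_cases j <;>
      simp [Matrix.mul_apply, Fin.sum_univ_two, h'] <;> norm_num⟩

/-- The sign `(-1) ^ b` of a bit. -/
def bitSign (b : Fin 2) : ℝ := if b = 0 then 1 else -1

lemma bitSign_add (a b : Fin 2) : bitSign (a + b) = bitSign a * bitSign b := by
  fin_cases a <;> fin_cases b <;> simp [bitSign]

lemma bitSign_mul_self (a : Fin 2) : bitSign a * bitSign a = 1 := by
  fin_cases a <;> simp [bitSign]

lemma bitSign_sum {ι : Type*} (S : Finset ι) (z : ι → Fin 2) :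
    bitSign (∑ j ∈ S, z j) = ∏ j ∈ S, bitSign (z j) := by
  classical
  induction S using Finset.induction_on with
  | empty => simp [bitSign]
  | insert a S ha ih => rw [Finset.sum_insert ha, Finset.prod_insert ha, bitSign_add, ih]

/-- The phase gate `exp (i c Z)`, with `Z` the Pauli matrix. -/
noncomputable def phase (c : ℝ) : Matrix.unitaryGroup (Fin 2) ℂ :=
  ⟨Matrix.diagonal fun b => Complex.exp ((c * bitSign b : ℝ) * Complex.I), by
    rw [Matrix.mem_unitaryGroup_iff, Matrix.star_eq_conjTranspose, Matrix.diagonal_conjTranspose,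
      Matrix.diagonal_mul_diagonal, ← Matrix.diagonal_one]
    congr 1
    funext b
    rw [Pi.star_apply, Complex.star_def, Complex.mul_conj, Complex.normSq_eq_norm_sq,
      Complex.norm_exp_ofReal_mul_I]
    norm_num⟩

lemma one_phase_toMatrix (w : W) (c : ℝ) :
    (Gate.one w (phase c)).toMatrix =
      Matrix.diagonal fun y => Complex.exp ((c * bitSign (y w) : ℝ) * Complex.I) := by
  ext x y
  by_cases hxy : x = y
  · subst hxy; simp [Gate.toMatrix, phase]
  · by_cases h : ∀ s, s ≠ w → x s = y s
    · have hw : x w ≠ y w := fun hw => hxy <| funext fun s => by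
        by_cases hs : s = w
        · rw [hs, hw]
        · exact h s hs
      simp [Gate.toMatrix, phase, hxy, hw]
    · simp [Gate.toMatrix, hxy, h]

/-- A phase gate on every wire. -/
noncomputable def phaseLayer (c : W → ℝ) : Layer W where
  gates := Finset.univ.toList.map fun w => Gate.one w (phase (c w))
  disjoint := by
    rw [List.pairwise_map]
    refine (Finset.nodup_toList _).imp fun {a b} hab => ?_
    simpa [Gate.wires] using hab

lemma phaseLayer_toMatrix (c : W → ℝ) :
    (phaseLayer c).toMatrix =
      Matrix.diagonal fun y => Complex.exp ((∑ w, c w * bitSign (y w) : ℝ) * Complex.I) := by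
  have key : ∀ l : List W,
      ((l.map fun w => Gate.one w (phase (c w))).map Gate.toMatrix).prod =
        Matrix.diagonal fun y =>
          Complex.exp (((l.map fun w => c w * bitSign (y w)).sum : ℝ) * Complex.I) := by
    intro l
    induction l with
    | nil => simp
    | cons w l ih =>
      simp only [List.map_cons, List.prod_cons, List.sum_cons, ih, one_phase_toMatrix,
        Matrix.diagonal_mul_diagonal, ← Complex.exp_add, Complex.ofReal_add, add_mul]
  have h := key Finset.univ.toList
  simp only [Finset.sum_map_toList] at h
  exact h

/-- The layer consisting of one gate. -/
def Layer.single (g : Gate W) : Layer W := ⟨[g], List.pairwise_singleton _ _⟩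

lemma Layer.single_toMatrix (g : Gate W) : (Layer.single g).toMatrix = g.toMatrix := by
  simp [Layer.single, Layer.toMatrix]

/-- Between two Hadamard gates on `w`, a diagonal operator is averaged over the qubit `w`, in the
block where this qubit is `0`. -/
lemma hadamard_conj_diagonal_apply (w : W) (g : (W → Fin 2) → ℂ) {x y : W → Fin 2}
    (hx : x w = 0) (hy : y w = 0) :
    ((Gate.one w hadamard).toMatrix * Matrix.diagonal g * (Gate.one w hadamard).toMatrix) x y =
      if x = y then (g x + g (Function.update x w 1)) / 2 else 0 := by
  have h : ((Real.sqrt 2 : ℝ) : ℂ) * ((Real.sqrt 2 : ℝ) : ℂ) = 2 := by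
    rw [← Complex.ofReal_mul, Real.mul_self_sqrt (by norm_num)]; norm_num
  have h' : ((Real.sqrt 2 : ℝ) : ℂ)⁻¹ * ((Real.sqrt 2 : ℝ) : ℂ)⁻¹ = 1 / 2 := by
    rw [← mul_inv, h]; norm_num
  have hx0 : Function.update x w 0 = x := by rw [← hx]; exact Function.update_eq_self w x
  have hiff : ∀ b, (∀ s, s ≠ w → Function.update x w b s = y s) ↔ x = y := by
    intro b
    constructor
    · intro H
      funext s
      by_cases hs : s = w
      · rw [hs, hx, hy]
      · rw [← H s hs, Function.update_of_ne hs]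
    · rintro rfl s hs
      rw [Function.update_of_ne hs]
  rw [Matrix.mul_assoc, Matrix.mul_apply, sum_one_toMatrix_mul]
  simp only [Matrix.diagonal_mul, Gate.toMatrix, Matrix.of_apply, hiff, Function.update_self,
    Fin.sum_univ_two, hx, hy, hx0]
  by_cases hxy : x = y
  · simp only [hxy, if_true, hadamard, Matrix.smul_apply]
    simp only [Matrix.of_apply, Matrix.cons_val_zero, Matrix.cons_val_one,
      one_div, smul_eq_mul, mul_one, Complex.ofReal_inv]
    linear_combination (g y + g (Function.update y w 1)) * h'
  · simp [hxy]

/-! ### Controlled negations -/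

/-- The controlled negation `|a, b⟩ ↦ |a, a + b⟩`. -/
noncomputable def cnot : Matrix.unitaryGroup (Fin 2 × Fin 2) ℂ :=
  ⟨Matrix.of fun p q => if p = (q.1, q.2 + q.1) then 1 else 0, by
    rw [Matrix.mem_unitaryGroup_iff]
    ext ⟨i, j⟩ ⟨k, l⟩
    simp only [Matrix.mul_apply, Fintype.sum_prod_type, Fin.sum_univ_two, Matrix.star_apply,
      Matrix.of_apply, Matrix.one_apply]
    fin_cases i <;> fin_cases j <;> fin_cases k <;> fin_cases l <;> simp⟩

lemma two_cnot_toMatrix {v w : W} (hvw : v ≠ w) :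
    (Gate.two v w hvw cnot).toMatrix = ketMap fun y => Function.update y w (y w + y v) := by
  ext x y
  have h : x = Function.update y w (y w + y v) ↔
      (∀ s, s ≠ v → s ≠ w → x s = y s) ∧ (x v, x w) = (y v, y w + y v) := by
    rw [Function.eq_update_iff, Prod.mk.injEq]
    constructor
    · rintro ⟨h1, h2⟩
      exact ⟨fun s _ hs => h2 s hs, h2 v hvw, h1⟩
    · rintro ⟨h1, h2, h3⟩
      refine ⟨h3, fun s hs => ?_⟩
      by_cases hsv : s = v
      · rw [hsv, h2]
      · exact h1 s hsv hs
  simp only [ketMap, Matrix.of_apply, h, Gate.toMatrix, cnot, ite_and]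

/-! ### Circuits -/

lemma Circuit.toMatrix_append (c d : Circuit W) :
    Circuit.toMatrix (c ++ d) = Circuit.toMatrix d * Circuit.toMatrix c := by
  induction c with
  | nil => simp [Circuit.toMatrix]
  | cons l c ih => simp [Circuit.toMatrix, ih, Matrix.mul_assoc]

end Register

section Relabel

variable {V W : Type} [Fintype V] [DecidableEq V] [Fintype W] [DecidableEq W]

/-- The same gate on relabelled wires. -/
def Gate.map (e : V ≃ W) : Gate V → Gate W
  | .one w u => .one (e w) u
  | .two v w hvw u => .two (e v) (e w) (e.injective.ne hvw) u

omit [Fintype V] [Fintype W] in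
lemma Gate.map_wires (e : V ≃ W) (g : Gate V) :
    (g.map e).wires = g.wires.map e.toEmbedding := by
  cases g <;> simp [Gate.map, Gate.wires]

lemma Gate.map_toMatrix (e : V ≃ W) (g : Gate V) :
    (g.map e).toMatrix =
      g.toMatrix.submatrix (e.symm.arrowCongr (Equiv.refl _)) (e.symm.arrowCongr (Equiv.refl _)) := by
  ext x y
  cases g <;> simp [Gate.map, Gate.toMatrix, ← e.forall_congr_right]

/-- The same layer on relabelled wires. -/
def Layer.map (e : V ≃ W) (l : Layer V) : Layer W where
  gates := l.gates.map (Gate.map e)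
  disjoint := by
    rw [List.pairwise_map]
    refine l.disjoint.imp fun {g h} H => ?_
    rw [Gate.map_wires, Gate.map_wires, Finset.disjoint_map]
    exact H

lemma Layer.map_toMatrix (e : V ≃ W) (l : Layer V) :
    (l.map e).toMatrix =
      l.toMatrix.submatrix (e.symm.arrowCongr (Equiv.refl _)) (e.symm.arrowCongr (Equiv.refl _)) := by
  obtain ⟨gs, hgs⟩ := l
  simp only [Layer.map, Layer.toMatrix]
  clear hgs
  induction gs with
  | nil => simp
  | cons g gs ih =>
    simp only [List.map_cons, List.prod_cons, ih, Gate.map_toMatrix, Matrix.submatrix_mul_equiv]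

lemma Circuit.map_toMatrix (e : V ≃ W) (c : Circuit V) :
    Circuit.toMatrix (c.map (Layer.map e)) =
      (Circuit.toMatrix c).submatrix (e.symm.arrowCongr (Equiv.refl _))
        (e.symm.arrowCongr (Equiv.refl _)) := by
  induction c with
  | nil => simp [Circuit.toMatrix]
  | cons l c ih =>
    simp only [List.map_cons, Circuit.toMatrix, ih, Layer.map_toMatrix,
      Matrix.submatrix_mul_equiv]

end Relabel

/-! ### Computing all parities -/

section Parity

variable {ι : Type} [Fintype ι] [DecidableEq ι]

/-- The effect of the layer `t` on the contents of the wires `S ⊆ ι`: each wire `S ∌ t` is added to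
the wire `insert t S`. -/
def stepAdd (t : ι) (y : Finset ι → Fin 2) : Finset ι → Fin 2 :=
  fun U => if t ∈ U then y U + y (U.erase t) else y U

omit [Fintype ι] in
lemma stepAdd_stepAdd (t : ι) (y : Finset ι → Fin 2) : stepAdd t (stepAdd t y) = y := by
  have h2 : ∀ a b : Fin 2, a + b + b = a := by decide
  funext U
  by_cases h : t ∈ U <;> simp [stepAdd, h, h2]

/-- The CNOT gate from `S` to `insert t S`, if `t ∉ S`. (The control is written as `S.erase t` to
have distinct wires for all `S`.) -/
noncomputable def cnotGate (t : ι) (S : Finset ι) : Gate (Finset ι) :=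
  .two (S.erase t) (insert t S) (fun h => by
    have : t ∈ S.erase t := h ▸ Finset.mem_insert_self t S
    simp at this) cnot

/-- The gates `cnotGate t S` for all `S ∌ t`. -/
noncomputable def cnotLayer (t : ι) : Layer (Finset ι) where
  gates := (Finset.univ.filter fun S : Finset ι => t ∉ S).toList.map (cnotGate t)
  disjoint := by
    rw [List.pairwise_map]
    refine List.Pairwise.imp_of_mem ?_ (Finset.nodup_toList _)
    intro A B hA hB hAB
    simp only [Finset.mem_toList, Finset.mem_filter, Finset.mem_univ, true_and] at hA hB
    have h1 : A ≠ insert t B := fun h => hA (h ▸ Finset.mem_insert_self t B)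
    have h2 : insert t A ≠ B := fun h => hB (h ▸ Finset.mem_insert_self t A)
    have h3 : insert t A ≠ insert t B := fun h => hAB <| by
      rw [← Finset.erase_insert hA, h, Finset.erase_insert hB]
    simp [cnotGate, Gate.wires, Finset.erase_eq_of_notMem, hA, hB,
      hAB.symm, h1.symm, h2.symm, h3.symm]

lemma cnotLayer_toMatrix (t : ι) : (cnotLayer t).toMatrix = ketMap (stepAdd t) := by
  have key : ∀ l : List (Finset ι), l.Nodup → (∀ S ∈ l, t ∉ S) →
      ((l.map (cnotGate t)).map Gate.toMatrix).prod =
        ketMap fun y U => if t ∈ U ∧ U.erase t ∈ l then y U + y (U.erase t) else y U := by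
    intro l
    induction l with
    | nil =>
      intro _ _
      simp only [List.map_nil, List.prod_nil, List.not_mem_nil, and_false, if_false]
      exact ketMap_id.symm
    | cons S l ih =>
      intro hnd hl
      obtain ⟨hS, hnd⟩ := List.nodup_cons.1 hnd
      have htS : t ∉ S := hl S List.mem_cons_self
      simp only [List.map_cons, List.prod_cons, ih hnd fun T hT => hl T (List.mem_cons_of_mem _ hT),
        cnotGate, two_cnot_toMatrix, ketMap_mul]
      congr 1
      funext y U
      simp only [Function.comp, Function.update_apply, Finset.erase_eq_of_notMem htS]
      by_cases hU : U = insert t S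
      · subst hU
        simp [Finset.erase_insert htS, hS, htS]
      · have hne : ¬ (t ∈ U ∧ U.erase t = S) := by
          rintro ⟨h1, rfl⟩
          exact hU (Finset.insert_erase h1).symm
        by_cases h1 : t ∈ U
        · have h2 : U.erase t ≠ S := fun h => hne ⟨h1, h⟩
          simp [hU, h1, h2]
        · simp [hU, h1]
  have h := key (Finset.univ.filter fun S : Finset ι => t ∉ S).toList (Finset.nodup_toList _)
    (by simp)
  simp only [Finset.mem_toList, Finset.mem_filter, Finset.mem_univ,
    Finset.notMem_erase, not_false_eq_true, and_true] at h
  exact h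

/-- The contents of the wires after the layers `t ∈ A`, if bit `j` is on the wire `{j}` at the
start: the wire `U` holds the sum of those bits `j ∈ U` for which `U \ {j} ⊆ A`. -/
def partialParity (A : Finset ι) (z : ι → Fin 2) : Finset ι → Fin 2 :=
  fun U => ∑ j ∈ U, if U.erase j ⊆ A then z j else 0

omit [Fintype ι] in
lemma stepAdd_partialParity {t : ι} {A : Finset ι} (ht : t ∉ A) (z : ι → Fin 2) :
    stepAdd t (partialParity A z) = partialParity (insert t A) z := by
  funext U
  by_cases htU : t ∈ U
  · simp only [stepAdd, htU, if_true, partialParity]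
    rw [← Finset.add_sum_erase U _ htU, ← Finset.add_sum_erase U
      (fun j => if U.erase j ⊆ insert t A then z j else 0) htU]
    have h1 : ∑ j ∈ U.erase t, (if U.erase j ⊆ A then z j else 0) = 0 := by
      refine Finset.sum_eq_zero fun j hj => if_neg fun h => ht (h ?_)
      exact Finset.mem_erase.2 ⟨(Finset.ne_of_mem_erase hj).symm, htU⟩
    have h2 : U.erase t ⊆ insert t A ↔ U.erase t ⊆ A := by
      rw [Finset.subset_insert_iff, Finset.erase_idem]
    have h3 : ∀ j, (U.erase j ⊆ insert t A ↔ (U.erase t).erase j ⊆ A) := by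
      intro j
      rw [Finset.subset_insert_iff, Finset.erase_right_comm]
    simp only [h1, add_zero, h2]
    congr 1
    exact Finset.sum_congr rfl fun j _ => by simp only [h3]
  · simp only [stepAdd, htU, if_false, partialParity]
    refine Finset.sum_congr rfl fun j _ => ?_
    simp only [Finset.subset_insert_iff_of_notMem fun h => htU (Finset.mem_of_mem_erase h)]

omit [Fintype ι] in
lemma partialParity_empty_singleton (z : ι → Fin 2) (j : ι) : partialParity ∅ z {j} = z j := by
  simp [partialParity]

omit [Fintype ι] in
lemma partialParity_empty_of_forall_ne (z : ι → Fin 2) {U : Finset ι} (h : ∀ j, U ≠ {j}) :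
    partialParity ∅ z U = 0 := by
  refine Finset.sum_eq_zero fun j hj => if_neg fun hU => h j ?_
  rw [Finset.subset_empty, Finset.erase_eq_empty_iff] at hU
  exact hU.resolve_left (Finset.ne_empty_of_mem hj)

lemma partialParity_univ (z : ι → Fin 2) (U : Finset ι) :
    partialParity Finset.univ z U = ∑ j ∈ U, z j := by
  simp [partialParity]

/-- The effect of the layers `t ∈ ts`, the head of the list being carried out first. -/
def stepsAdd (ts : List ι) (y : Finset ι → Fin 2) : Finset ι → Fin 2 :=
  ts.foldl (fun y t => stepAdd t y) y

lemma map_cnotLayer_toMatrix (ts : List ι) :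
    Circuit.toMatrix (ts.map cnotLayer) = ketMap (stepsAdd ts) := by
  induction ts with
  | nil => exact ketMap_id.symm
  | cons t ts ih =>
    rw [List.map_cons, Circuit.toMatrix, ih, cnotLayer_toMatrix, ketMap_mul]
    rfl

omit [Fintype ι] in
lemma stepsAdd_reverse_comp (ts : List ι) : stepsAdd ts.reverse ∘ stepsAdd ts = id := by
  funext y
  induction ts generalizing y with
  | nil => rfl
  | cons t ts ih =>
    have h := ih (stepAdd t y)
    simp only [stepsAdd, Function.comp, id, List.foldl_cons, List.reverse_cons,
      List.foldl_append, List.foldl_nil] at h ⊢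
    rw [h, stepAdd_stepAdd]

omit [Fintype ι] in
lemma stepsAdd_partialParity (ts : List ι) (hts : ts.Nodup) (A : Finset ι)
    (hA : ∀ t ∈ ts, t ∉ A) (z : ι → Fin 2) :
    stepsAdd ts (partialParity A z) = partialParity (A ∪ ts.toFinset) z := by
  induction ts generalizing A with
  | nil => simp [stepsAdd]
  | cons t ts ih =>
    obtain ⟨ht, hts⟩ := List.nodup_cons.1 hts
    have h := ih hts (insert t A) fun s hs => by
      rw [Finset.mem_insert, not_or]
      exact ⟨fun h => ht (h ▸ hs), hA s (List.mem_cons_of_mem _ hs)⟩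
    simp only [stepsAdd, List.foldl_cons] at h ⊢
    rw [stepAdd_partialParity (hA t List.mem_cons_self), h, List.toFinset_cons,
      Finset.insert_union, Finset.union_insert]

lemma stepsAdd_univ_partialParity_empty (z : ι → Fin 2) :
    stepsAdd Finset.univ.toList (partialParity ∅ z) = fun U => ∑ j ∈ U, z j := by
  rw [stepsAdd_partialParity _ (Finset.nodup_toList _) _ (by simp)]
  funext U
  rw [Finset.toList_toFinset, Finset.empty_union, partialParity_univ]

/-! ### Diagonal unitaries -/

/-- The Walsh expansion: every function of finitely many bits is a linear combination of the signs
of their partial parities. -/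
lemma exists_walsh (φ : (ι → Fin 2) → ℝ) :
    ∃ c : Finset ι → ℝ, ∀ z, ∑ S, c S * bitSign (∑ j ∈ S, z j) = φ z := by
  refine ⟨fun S => ∑ y, φ y / 2 ^ Fintype.card ι * bitSign (∑ j ∈ S, y j), fun z => ?_⟩
  -- the indicator function of `y` is the product of the factors `(1 ± 1) / 2`
  have hδ : ∀ y, ∏ j, (1 + bitSign (y j) * bitSign (z j))
      = if y = z then 2 ^ Fintype.card ι else 0 := by
    intro y
    split_ifs with h
    · subst h
      simp [bitSign_mul_self, one_add_one_eq_two]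
    · obtain ⟨j, hj⟩ := Function.ne_iff.1 h
      refine Finset.prod_eq_zero (Finset.mem_univ j) ?_
      revert hj
      generalize y j = a
      generalize z j = b
      fin_cases a <;> fin_cases b <;> simp [bitSign]
  have h2 : (2 : ℝ) ^ Fintype.card ι ≠ 0 := by positivity
  calc _ = ∑ y, φ y / 2 ^ Fintype.card ι * ∏ j, (1 + bitSign (y j) * bitSign (z j)) := by
        simp only [Finset.sum_mul]
        rw [Finset.sum_comm]
        refine Finset.sum_congr rfl fun y _ => ?_
        rw [Finset.prod_one_add, Finset.powerset_univ, Finset.mul_sum]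
        refine Finset.sum_congr rfl fun S _ => ?_
        rw [bitSign_sum, bitSign_sum, Finset.prod_mul_distrib, mul_assoc]
    _ = φ z := by
        simp [hδ, h2]

/-- Every diagonal unitary on the bits of `ι` extends to a diagonal unitary of depth
`2 |ι| + 1` on one qubit for each subset of `ι`, where bit `j` is on the wire `{j}` and the other
wires are `0`. -/
lemma exists_circuit_diagonal (φ : (ι → Fin 2) → ℝ) :
    ∃ (c : Circuit (Finset ι)) (ψ : (Finset ι → Fin 2) → ℝ),
      Circuit.toMatrix c = Matrix.diagonal (fun y => Complex.exp (ψ y * Complex.I)) ∧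
      (∀ z, ψ (partialParity ∅ z) = φ z) ∧ c.depth = 2 * Fintype.card ι + 1 := by
  obtain ⟨a, ha⟩ := exists_walsh φ
  refine ⟨Finset.univ.toList.map cnotLayer ++
      (phaseLayer a :: Finset.univ.toList.reverse.map cnotLayer),
    fun y => ∑ S, a S * bitSign (stepsAdd Finset.univ.toList y S), ?_, fun z => ?_, ?_⟩
  · rw [Circuit.toMatrix_append, Circuit.toMatrix, map_cnotLayer_toMatrix, map_cnotLayer_toMatrix,
      phaseLayer_toMatrix, ketMap_mul_diagonal_mul_ketMap (stepsAdd_reverse_comp _)]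
    rfl
  · simp only [stepsAdd_univ_partialParity_empty, ha]
  · simp only [Circuit.depth, List.length_append, List.length_map, List.length_cons,
      List.length_reverse, Finset.length_toList, Finset.card_univ]
    ring

end Parity

/-! ### Block encodings of diagonal matrices -/

/-- Every diagonal operator with entries in `[-1, 1]` on `k` qubits is the `⟨0|·|0⟩` block of a
circuit of depth `2 k + 5`. -/
lemma exists_circuit_block {k : ℕ} (d : (Fin k → Fin 2) → ℝ) (hd : ∀ x, |d x| ≤ 1) :
    ∃ (a : ℕ) (c : Circuit (Fin a ⊕ Fin k)),
      Circuit.toMatrix c ∈ Matrix.unitaryGroup (Fin a ⊕ Fin k → Fin 2) ℂ ∧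
      (∀ x y : Fin k → Fin 2, Circuit.toMatrix c (Sum.elim (fun _ => 0) x)
        (Sum.elim (fun _ => 0) y) = if x = y then (d x : ℂ) else 0) ∧
      c.depth = 2 * k + 5 := by
  -- the bit `none` of `Option (Fin k)` is the qubit of the Hadamard gates
  let data : Fin k → Finset (Option (Fin k)) := fun j => {some j}
  have hdata : Function.Injective data := fun i j h => by simpa [data] using h
  let a := Fintype.card ((Set.range data)ᶜ : Set (Finset (Option (Fin k))))
  let e : Finset (Option (Fin k)) ≃ Fin a ⊕ Fin k :=
    (Equiv.Set.sumCompl (Set.range data)).symm.trans <| (Equiv.sumComm _ _).trans <|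
      Equiv.sumCongr (Fintype.equivFin _) (Equiv.ofInjective data hdata).symm
  have he : ∀ j, e {some j} = Sum.inr j := by
    intro j
    have hmem : ({some j} : Finset (Option (Fin k))) ∈ Set.range data := Set.mem_range_self j
    have h1 : (Equiv.Set.sumCompl (Set.range data)).symm {some j} = Sum.inl ⟨{some j}, hmem⟩ :=
      Equiv.Set.sumCompl_symm_apply_of_mem hmem
    have h2 : (Equiv.ofInjective data hdata).symm ⟨{some j}, hmem⟩ = j :=
      Equiv.ofInjective_symm_apply hdata j
    simp [e, h1, h2]
  obtain ⟨c, ψ, hc, hψ, hdepth⟩ := exists_circuit_diagonal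
    (fun z : Option (Fin k) → Fin 2 => bitSign (z none) * Real.arccos (d fun j => z (some j)))
  let h : Gate (Finset (Option (Fin k))) := .one {none} hadamard
  let C : Circuit (Finset (Option (Fin k))) := Layer.single h :: (c ++ [Layer.single h])
  have hC : Circuit.toMatrix C = h.toMatrix *
      Matrix.diagonal (fun y => Complex.exp (ψ y * Complex.I)) * h.toMatrix := by
    simp [C, Circuit.toMatrix, Circuit.toMatrix_append, hc, Layer.single_toMatrix]
  have hCu : Circuit.toMatrix C ∈ Matrix.unitaryGroup (Finset (Option (Fin k)) → Fin 2) ℂ := by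
    rw [hC]
    refine mul_mem (mul_mem (one_toMatrix_mem_unitaryGroup _ _) ?_)
      (one_toMatrix_mem_unitaryGroup _ _)
    rw [Matrix.mem_unitaryGroup_iff, Matrix.star_eq_conjTranspose, Matrix.diagonal_conjTranspose,
      Matrix.diagonal_mul_diagonal, ← Matrix.diagonal_one]
    congr 1
    funext y
    rw [Pi.star_apply, Complex.star_def, Complex.mul_conj, Complex.normSq_eq_norm_sq,
      Complex.norm_exp_ofReal_mul_I]
    norm_num
  refine ⟨a, C.map (Layer.map e), ?_, fun x y => ?_, ?_⟩
  · rw [Circuit.map_toMatrix, Matrix.mem_unitaryGroup_iff, Matrix.star_eq_conjTranspose,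
      Matrix.conjTranspose_submatrix, Matrix.submatrix_mul_equiv, ← Matrix.star_eq_conjTranspose,
      Matrix.mem_unitaryGroup_iff.1 hCu, Matrix.submatrix_one_equiv]
  · -- the contents of the wires before the circuit
    have hstart : ∀ (x : Fin k → Fin 2),
        e.symm.arrowCongr (Equiv.refl _) (Sum.elim (fun _ => 0) x) =
          partialParity ∅ (fun o : Option (Fin k) => o.elim 0 x) := by
      intro x
      funext U
      by_cases hU : ∃ j, U = {some j}
      · obtain ⟨j, rfl⟩ := hU
        simp [partialParity_empty_singleton, he]
      · have h0 : partialParity ∅ (fun o : Option (Fin k) => o.elim 0 x) U = 0 := by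
          by_cases hn : U = {none}
          · subst hn
            simp [partialParity_empty_singleton]
          · refine partialParity_empty_of_forall_ne _ fun o ho => ?_
            cases o with
            | none => exact hn ho
            | some j => exact hU ⟨j, ho⟩
        rw [h0]
        have h1 : ∃ i, e U = Sum.inl i := by
          rcases hi : e U with i | j
          · exact ⟨i, rfl⟩
          · exact absurd ⟨j, e.injective (hi.trans (he j).symm)⟩ hU
        obtain ⟨i, hi⟩ := h1
        simp [hi]
    have hflip : Function.update (partialParity ∅ (fun o : Option (Fin k) => o.elim 0 x)) {none} 1 =
        partialParity ∅ (fun o : Option (Fin k) => o.elim 1 x) := by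
      funext U
      by_cases hU : ∃ o, U = {o}
      · obtain ⟨o, rfl⟩ := hU
        cases o <;> simp [partialParity_empty_singleton]
      · rw [not_exists] at hU
        rw [Function.update_of_ne (hU none), partialParity_empty_of_forall_ne _ hU,
          partialParity_empty_of_forall_ne _ hU]
    have hinj : (partialParity ∅ (fun o : Option (Fin k) => o.elim 0 x) =
        partialParity ∅ (fun o : Option (Fin k) => o.elim 0 y)) ↔ x = y := by
      refine ⟨fun H => funext fun j => ?_, fun H => by rw [H]⟩
      simpa [partialParity_empty_singleton] using congrFun H {some j}
    rw [Circuit.map_toMatrix, Matrix.submatrix_apply, hstart, hstart, hC,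
      hadamard_conj_diagonal_apply _ _ (by simp [partialParity_empty_singleton])
        (by simp [partialParity_empty_singleton]), hflip, hψ, hψ]
    simp only [hinj]
    refine if_congr Iff.rfl ?_ rfl
    have hcos : Real.cos (Real.arccos (d x)) = d x :=
      Real.cos_arccos (abs_le.1 (hd x)).1 (abs_le.1 (hd x)).2
    conv_rhs => rw [← hcos]
    simp [bitSign, Complex.cos]
  · have h1 : c.length = 2 * (k + 1) + 1 := by
      simpa [Circuit.depth] using hdepth
    simp [C, Circuit.depth, h1]
    ring

lemma ketIndex_injective (k : ℕ) : Function.Injective (ketIndex (k := k)) := by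
  intro x y h
  have key : ∀ x : Fin k → Fin 2, (finFunctionFinEquiv fun j => x j.rev : ℕ) = ketIndex x := by
    intro x
    rw [finFunctionFinEquiv_apply, ketIndex]
    exact Fintype.sum_equiv Fin.revPerm _ _ (by simp)
  have h2 := finFunctionFinEquiv.injective (Fin.ext ((key x).trans (h.trans (key y).symm)))
  funext j
  simpa using congrFun h2 j.rev

lemma exists_isBlockEncoding_diagonal {n k : ℕ} (hn : n ≤ 2 ^ k) (d : Fin n → ℝ)
    (hd : ∀ i, |d i| ≤ 1) :
    ∃ (a : ℕ) (c : Circuit (Fin a ⊕ Fin k)),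
      IsBlockEncoding (Circuit.toMatrix c) (Matrix.diagonal fun i => (d i : ℂ)) ∧
      c.depth = 2 * k + 5 := by
  obtain ⟨a, c, hu, hb, hdepth⟩ := exists_circuit_block
    (fun x : Fin k → Fin 2 => if h : ketIndex x < n then d ⟨ketIndex x, h⟩ else 0)
    (fun x => by split_ifs <;> simp [hd])
  refine ⟨a, c, ⟨hn, hu, fun x y => ?_⟩, hdepth⟩
  rw [hb, onQubits, Matrix.of_apply]
  by_cases hxy : x = y
  · subst hxy
    by_cases h : ketIndex x < n <;> simp [h]
  · have hne : ketIndex x ≠ ketIndex y := (ketIndex_injective k).ne hxy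
    simp [hxy, hne]

end QCirc

theorem lemma2 :
    ∃ C : ℝ, ∀ (n : ℕ) (f : Polynomial ℝ) (P : ℝ) (x : Fin n → ℝ),
      2 ≤ n →
      0 < P →
      (∀ t ∈ Set.Icc (-(1 / 2) : ℝ) (1 / 2), |f.derivative.eval t| ≤ P) →
      (∀ i, x i ∈ Set.Icc (-(1 / 2) : ℝ) (1 / 2)) →
      (n < 4 → ∀ i, |f.derivative.eval (x (finRotate n i)) - f.derivative.eval (x i)|
        ≤ Real.sqrt n * P) →
      ∃ (a : ℕ) (c : QCirc.Circuit (Fin a ⊕ Fin (Nat.clog 2 n))),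
        QCirc.IsBlockEncoding (QCirc.Circuit.toMatrix c)
          (((1 / Real.sqrt n : ℝ) : ℂ) • QCirc.diffMatrix f P x) ∧
        (QCirc.Circuit.depth c : ℝ) ≤ C * (max 1 f.natDegree : ℕ) * Real.log n := by
  refine ⟨28, fun n f P x hn hP hf hx hsmall => ?_⟩
  have hdiff : ∀ i, |f.derivative.eval (x (finRotate n i)) - f.derivative.eval (x i)|
      ≤ Real.sqrt n * P := by
    intro i
    rcases lt_or_ge n 4 with h4 | h4
    · exact hsmall h4 i
    · have h2 : (2 : ℝ) ≤ Real.sqrt n := Real.le_sqrt_of_sq_le (by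
        have : (4 : ℝ) ≤ n := by exact_mod_cast h4
        linarith)
      have h := abs_sub (f.derivative.eval (x (finRotate n i))) (f.derivative.eval (x i))
      nlinarith [hf _ (hx (finRotate n i)), hf _ (hx i)]
  have hsqrt : 0 < Real.sqrt n := Real.sqrt_pos.2 (by positivity)
  obtain ⟨a, c, hc, hdepth⟩ := QCirc.exists_isBlockEncoding_diagonal (Nat.le_pow_clog one_lt_two n)
    (fun i => 1 / Real.sqrt n *
      ((f.derivative.eval (x (finRotate n i)) - f.derivative.eval (x i)) / P))
    (fun i => by
      rw [abs_mul, abs_div _ P, abs_of_pos hP, abs_of_pos (one_div_pos.2 hsqrt), div_mul_div_comm,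
        one_mul, div_le_one (by positivity)]
      exact hdiff i)
  refine ⟨a, c, ?_, ?_⟩
  · convert hc using 1
    ext i j
    by_cases hij : i = j
    · subst hij; simp [QCirc.diffMatrix]
    · simp [QCirc.diffMatrix, hij]
  · have hlog2 : Real.log 2 ≤ Real.log n := Real.log_le_log (by norm_num) (by exact_mod_cast hn)
    have hl : (1 / 2 : ℝ) < Real.log 2 := by linarith [Real.log_two_gt_d9]
    -- `2 ^ (k - 1) < n` for `k = ⌈log₂ n⌉ ≥ 1`
    have hk : ((Nat.clog 2 n : ℕ) : ℝ) * Real.log 2 ≤ Real.log n + Real.log 2 := by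
      have hk1 : 0 < Nat.clog 2 n := Nat.clog_pos one_lt_two hn
      have h1 : 2 ^ (Nat.clog 2 n).pred < n := Nat.pow_pred_clog_lt_self one_lt_two hn
      have h2 : (2 : ℝ) ^ (Nat.clog 2 n).pred ≤ n := by exact_mod_cast h1.le
      have h3 := Real.log_le_log (by positivity) h2
      rw [Real.log_pow, Nat.pred_eq_sub_one, Nat.cast_sub hk1, Nat.cast_one] at h3
      linarith
    have hk' : ((Nat.clog 2 n : ℕ) : ℝ) ≤ 4 * Real.log n := by
      have : (0 : ℝ) ≤ (Nat.clog 2 n : ℕ) := Nat.cast_nonneg _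
      nlinarith
    have hm : (1 : ℝ) ≤ (max 1 f.natDegree : ℕ) := by exact_mod_cast le_max_left _ _
    have hpos : 0 ≤ Real.log n := by linarith
    rw [hdepth]
    push_cast at hm ⊢
    nlinarith [mul_le_mul_of_nonneg_right hm hpos]
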